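/- Let $M$ be a smooth ($T_2$, second countable) $m$-dimensional real manifold, and let $U\subset M$ be an open subset contained in the domain of a single chart of $M$. For a smooth manifold $N$ let $C^\infty(N)$ be the space of complex-valued smooth functions on $N$, with pointwise operations and the locally convex topology of uniform convergence of all derivatives on compact subsets of charts, i.e. the topology given by the seminorms $f\mapsto \sup_{x\in\omega(K)}\|D^n(f\circ\omega^{-1})(x)\|$, where $(W,\omega)$ is a chart of $N$, $K\subset W$ is compact and $n\ge 0$. Regard $C^\infty(U)$ as a module over the algebra $C^\infty(M)$ by $(g\cdot f)(s)=g(s)f(s)$, and $C^\infty(M\times U)$ by $(g\cdot F)(s,t)=g(s)F(s,t)$. Then $C^\infty(U)$ is a projective $C^\infty(M)$-module in the topological sense: whenever $X,Y$ are complete Hausdorff locally convex complex vector spaces with jointly continuous (unital) $C^\infty(M)$-module structures, $\sigma:X\to Y$ is a continuous module morphism which has a right inverse that is a continuous linear operator, and $\varphi:C^\infty(U)\to Y$ is a continuous module morphism, there is a continuous module morphism $\psi:C^\infty(U)\to X$ with $\sigma\psi=\varphi$. Moreover, the canonical projection $\pi_U:C^\infty(M\times U)\to C^\infty(U)$, $(\pi_U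 F)(s)=F(s,s)$, has a right inverse $\rho:C^\infty(U)\to C^\infty(M\times U)$, $\pi_U\rho=1_{C^\infty(U)}$, which is a continuous $C^\infty(M)$-module morphism. -/

import Mathlib

open scoped Manifold ContDiff

universe u v w

noncomputable section

namespace SmoothModules

section Algebra

variable {E : Type*} [NormedAddCommGroup E] [NormedSpace ℝ E]
  {H : Type*} [TopologicalSpace H] {I : ModelWithCorners ℝ E H}
  {N : Type*} [TopologicalSpace N] [ChartedSpace H N]

/-- The field `ℂ`, as a real manifold, is a smooth ring. -/
instance instContMDiffRingComplex : ContMDiffRing 𝓘(ℝ, ℂ) ∞ ℂ :=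
  { (inferInstance : LieAddGroup 𝓘(ℝ, ℂ) ∞ ℂ) with
    contMDiff_mul := by
      have h : ContDiff ℝ ∞ fun p : ℂ × ℂ => p.1 * p.2 := contDiff_fst.mul contDiff_snd
      have h' := h.contMDiff
      rwa [modelWithCornersSelf_prod, ← chartedSpaceSelf_prod] at h' }

/-- Complex scalars act pointwise on complex-valued smooth functions on a real manifold, which
makes `C^∞(N)` an algebra over `ℂ` (the ring structure is Mathlib's pointwise one). -/
instance instAlgebraComplex : Algebra ℂ C^∞⟮I, N; 𝓘(ℝ, ℂ), ℂ⟯ where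
  smul c f := ⟨fun x => c * f x, contMDiff_const.mul f.contMDiff⟩
  algebraMap :=
    { toFun := fun c => ⟨fun _ => c, contMDiff_const⟩
      map_one' := rfl
      map_mul' := fun _ _ => rfl
      map_zero' := rfl
      map_add' := fun _ _ => rfl }
  commutes' _ f := by ext x; exact mul_comm _ (f x)
  smul_def' _ _ := rfl

theorem complex_smul_apply (c : ℂ) (f : C^∞⟮I, N; 𝓘(ℝ, ℂ), ℂ⟯) (x : N) :
    (c • f) x = c * f x := rfl

end Algebra

section Topology

variable {E : Type*} [NormedAddCommGroup E] [NormedSpace ℝ E]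
  {H : Type*} [TopologicalSpace H] (I : ModelWithCorners ℝ E H)
  (N : Type*) [TopologicalSpace N] [ChartedSpace H N]

/-- Index set of the defining seminorms: a chart `e` of the smooth structure, a compact subset
`K` of its domain, and an order of differentiation `n`. -/
structure SeminormIndex where
  /-- the chart -/
  e : OpenPartialHomeomorph N H
  he : e ∈ IsManifold.maximalAtlas I ∞ N
  /-- the compact set -/
  K : Set N
  isCompact_K : IsCompact K
  K_subset : K ⊆ e.source
  /-- the order of differentiation -/
  n : ℕ

variable {I N}

theorem contDiffAt_chart [I.Boundaryless] (i : SeminormIndex I N)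
    (f : C^∞⟮I, N; 𝓘(ℝ, ℂ), ℂ⟯) {y : E} (hy : y ∈ (i.e.extend I).target) :
    ContDiffAt ℝ ∞ (f ∘ (i.e.extend I).symm) y := by
  have h1 := contMDiffOn_extend_symm i.he
  rw [← i.e.extend_target'] at h1
  have h2 : ContMDiffOn 𝓘(ℝ, E) 𝓘(ℝ, ℂ) ∞ (f ∘ (i.e.extend I).symm) (i.e.extend I).target :=
    f.contMDiff.comp_contMDiffOn h1
  exact (contMDiffOn_iff_contDiffOn.mp h2).contDiffAt (i.e.isOpen_extend_target.mem_nhds hy)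

theorem chart_mem_target (i : SeminormIndex I N) (x : i.K) :
    i.e.extend I x ∈ (i.e.extend I).target :=
  (i.e.extend I).map_source (by rw [i.e.extend_source]; exact i.K_subset x.2)

theorem bddAbove_chart [I.Boundaryless] (i : SeminormIndex I N)
    (f : C^∞⟮I, N; 𝓘(ℝ, ℂ), ℂ⟯) :
    BddAbove (Set.range fun x : i.K =>
      ‖iteratedFDeriv ℝ i.n (f ∘ (i.e.extend I).symm) (i.e.extend I x)‖) := by
  have hc : ContinuousOn (fun x : N =>
      ‖iteratedFDeriv ℝ i.n (f ∘ (i.e.extend I).symm) (i.e.extend I x)‖) i.K := by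
    intro x hx
    have h1 : ContinuousAt (iteratedFDeriv ℝ i.n (f ∘ (i.e.extend I).symm)) (i.e.extend I x) :=
      ((contDiffAt_chart i f (chart_mem_target i ⟨x, hx⟩)).iteratedFDeriv_right
        (m := 0) (i := i.n) (by simp; exact_mod_cast le_top)).continuousAt
    have h2 : ContinuousAt (i.e.extend I) x := i.e.continuousAt_extend (i.K_subset hx)
    exact (ContinuousAt.comp (f := i.e.extend I) h1 h2).norm.continuousWithinAt
  have := i.isCompact_K.bddAbove_image hc
  rwa [Set.image_eq_range] at this

/-- The seminorm `f ↦ sup_{x ∈ K} ‖Dⁿ (f ∘ ω⁻¹) (ω x)‖` on `C^∞(N)`, for a chart `ω` of `N`, a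
compact subset `K` of the domain of `ω` and `n : ℕ`. All partial derivatives of order `n` in the
chart are collected in the `n`-th derivative. -/
def chartSeminorm [I.Boundaryless] (i : SeminormIndex I N) :
    Seminorm ℂ C^∞⟮I, N; 𝓘(ℝ, ℂ), ℂ⟯ :=
  Seminorm.of
    (fun f => ⨆ x : i.K, ‖iteratedFDeriv ℝ i.n (f ∘ (i.e.extend I).symm) (i.e.extend I x)‖)
    (by
      intro f g
      refine Real.iSup_le (fun x => ?_) (add_nonneg
        (Real.iSup_nonneg fun _ => norm_nonneg _) (Real.iSup_nonneg fun _ => norm_nonneg _))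
      have hf := (contDiffAt_chart i f (chart_mem_target i x)).of_le (m := i.n)
        (by exact_mod_cast le_top)
      have hg := (contDiffAt_chart i g (chart_mem_target i x)).of_le (m := i.n)
        (by exact_mod_cast le_top)
      have h : (⇑(f + g) ∘ (i.e.extend I).symm)
          = (f ∘ (i.e.extend I).symm) + (g ∘ (i.e.extend I).symm) := rfl
      rw [h, iteratedFDeriv_add_apply hf hg]
      exact (norm_add_le _ _).trans
        (add_le_add (le_ciSup (bddAbove_chart i f) x) (le_ciSup (bddAbove_chart i g) x)))
    (by
      intro c f
      rw [Real.mul_iSup_of_nonneg (norm_nonneg c)]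
      congr 1
      funext x
      have hf := (contDiffAt_chart i f (chart_mem_target i x)).of_le (m := i.n)
        (by exact_mod_cast le_top)
      have h : (⇑(c • f) ∘ (i.e.extend I).symm) = c • (f ∘ (i.e.extend I).symm) := rfl
      rw [h, iteratedFDeriv_const_smul_apply hf, norm_smul])

variable (I N) in
/-- The family of all chart seminorms on `C^∞(N)`. -/
def chartSeminormFamily [I.Boundaryless] :
    SeminormFamily ℂ C^∞⟮I, N; 𝓘(ℝ, ℂ), ℂ⟯ (SeminormIndex I N) :=
  chartSeminorm

/-- The topology of `C^∞(N)`: the locally convex topology generated by the chart seminorms, that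
is, uniform convergence of all derivatives on compact subsets of charts. -/
instance instTopologicalSpaceSmooth [I.Boundaryless] :
    TopologicalSpace C^∞⟮I, N; 𝓘(ℝ, ℂ), ℂ⟯ :=
  (chartSeminormFamily I N).moduleFilterBasis.topology

theorem withSeminorms_chartSeminormFamily [I.Boundaryless] :
    WithSeminorms (chartSeminormFamily I N) := ⟨rfl⟩

end Topology

section Modules

variable {E : Type*} [NormedAddCommGroup E] [NormedSpace ℝ E]
  {H : Type*} [TopologicalSpace H] {I : ModelWithCorners ℝ E H}
  {M : Type*} [TopologicalSpace M] [ChartedSpace H M]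
  {E' : Type*} [NormedAddCommGroup E'] [NormedSpace ℝ E']
  {H' : Type*} [TopologicalSpace H'] {I' : ModelWithCorners ℝ E' H'}
  {N : Type*} [TopologicalSpace N] [ChartedSpace H' N]

/-- `C^∞(U)` as a module over `C^∞(M)`, for `U` open in `M`: `(g • f)(s) = g(s) f(s)`. -/
instance instModuleOpens (U : TopologicalSpace.Opens M) :
    Module C^∞⟮I, M; 𝓘(ℝ, ℂ), ℂ⟯ C^∞⟮I, U; 𝓘(ℝ, ℂ), ℂ⟯ where
  smul g f := ⟨fun s => g s * f s, (g.contMDiff.comp contMDiff_subtype_val).mul f.contMDiff⟩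
  one_smul f := by ext s; exact one_mul (f s)
  mul_smul g h f := by ext s; exact mul_assoc (g s) (h s) (f s)
  smul_zero g := by ext s; exact mul_zero (g s)
  smul_add g f f' := by ext s; exact mul_add (g s) (f s) (f' s)
  add_smul g h f := by ext s; exact add_mul (g s) (h s) (f s)
  zero_smul f := by ext s; exact zero_mul (f s)

/-- `C^∞(M × N)` as a module over `C^∞(M)`: `(g • F)(s, t) = g(s) F(s, t)`. -/
instance instModuleProd :
    Module C^∞⟮I, M; 𝓘(ℝ, ℂ), ℂ⟯ C^∞⟮I.prod I', M × N; 𝓘(ℝ, ℂ), ℂ⟯ where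
  smul g F := ⟨fun p => g p.1 * F p, (g.contMDiff.comp contMDiff_fst).mul F.contMDiff⟩
  one_smul F := by ext p; exact one_mul (F p)
  mul_smul g h F := by ext p; exact mul_assoc (g p.1) (h p.1) (F p)
  smul_zero g := by ext p; exact mul_zero (g p.1)
  smul_add g F F' := by ext p; exact mul_add (g p.1) (F p) (F' p)
  add_smul g h F := by ext p; exact add_mul (g p.1) (h p.1) (F p)
  zero_smul F := by ext p; exact zero_mul (F p)

/-- The canonical projection `π_U : C^∞(M × U) → C^∞(U)`, `(π_U F)(s) = F(s, s)`. -/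
def diagRestrict (U : TopologicalSpace.Opens M) :
    C^∞⟮I.prod I, M × U; 𝓘(ℝ, ℂ), ℂ⟯ →ₗ[C^∞⟮I, M; 𝓘(ℝ, ℂ), ℂ⟯] C^∞⟮I, U; 𝓘(ℝ, ℂ), ℂ⟯ where
  toFun F := ⟨fun s => F (s, s), F.contMDiff.comp (contMDiff_subtype_val.prodMk contMDiff_id)⟩
  map_add' _ _ := rfl
  map_smul' _ _ := rfl

end Modules

/-- Projectivity in the homology theory of locally convex algebras. The test objects are the
(unital) locally convex `A`-modules: complete Hausdorff locally convex complex vector spaces with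
a jointly continuous `A`-action compatible with the scalars; morphisms are the continuous
`A`-linear maps. An epimorphism `σ : X → Y` is admissible if it has a right inverse which is a
continuous `ℂ`-linear operator (not necessarily a morphism). The module `P` is projective if
every morphism from `P` to the target of an admissible epimorphism lifts along it to a morphism. -/
def IsTopologicallyProjective (A : Type u) [CommRing A] [Algebra ℂ A]
    [TopologicalSpace A] (P : Type w) [AddCommGroup P] [Module A P] [TopologicalSpace P] : Prop :=
  ∀ (X Y : Type v)
    [AddCommGroup X] [Module ℂ X] [Module A X] [IsScalarTower ℂ A X]
    [UniformSpace X] [IsUniformAddGroup X] [T2Space X] [CompleteSpace X]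
    [ContinuousSMul ℂ X] [LocallyConvexSpace ℝ X] [ContinuousSMul A X]
    [AddCommGroup Y] [Module ℂ Y] [Module A Y] [IsScalarTower ℂ A Y]
    [UniformSpace Y] [IsUniformAddGroup Y] [T2Space Y] [CompleteSpace Y]
    [ContinuousSMul ℂ Y] [LocallyConvexSpace ℝ Y] [ContinuousSMul A Y]
    (σ : X →L[A] Y) (τ : Y →L[ℂ] X), (∀ y, σ (τ y) = y) →
    ∀ φ : P →L[A] Y, ∃ ψ : P →L[A] X, ∀ p, σ (ψ p) = φ p

end SmoothModules

end

/-! Projectivity comes from a "dual basis" for C^∞(U). There are χ_j in C^∞(M) supported in U and a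
locally finite family k_j in C^∞(U) with Σ χ_j k_j = 1 on U (`exists_finsum_mul_eq_one`). Extension
by zero makes f ↦ χ_j f a continuous morphism C^∞(U) → C^∞(M), and f = Σ (χ_j f) • k_j. If τ is a
continuous linear right inverse of σ, the lift is ψ(f) = Σ (χ_j f) • τ(φ(k_j)); applying σ gives
back φ(f).

Convergence and continuity of ψ do not depend on the size of χ_j f. By local finiteness, every
neighbourhood of 0 contains the whole line ℂ k_j for all but finitely many j, and continuous linear
maps preserve this. Joint continuity of the action then forces each continuous seminorm of X to
vanish on all A • τ(φ(k_j)) for almost all j (`exists_finset_seminorm_smul_eq_zero`), so seen by one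
seminorm the series is a finite sum.

For π_U, take ρ(f)(s,t) = k(s,t) f(s), where k is a smooth cutoff equal to 1 on the diagonal and to
0 near the points with s outside U. Both constructions use operators f ↦ k · (f ∘ p), continuous by
`continuous_mulPullback`. -/

noncomputable section

namespace SmoothModules

open Filter Topology TopologicalSpace Set

/-! ### Derivative bounds for κ · (g ∘ θ). -/

section Calculus

variable {E F : Type*} [NormedAddCommGroup E] [NormedSpace ℝ E]
  [NormedAddCommGroup F] [NormedSpace ℝ F]

theorem exists_isOpen_contDiffOn {G : Type*} [NormedAddCommGroup G] [NormedSpace ℝ G]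
    {f : E → G} {x : E} (hf : ContDiffAt ℝ ∞ f x) (n : ℕ) :
    ∃ u, IsOpen u ∧ x ∈ u ∧ ContDiffOn ℝ n f u := by
  obtain ⟨u, hu, hfu⟩ := hf.contDiffOn (m := n) (by exact_mod_cast le_top) (by simp)
  obtain ⟨v, hvu, hv, hxv⟩ := mem_nhds_iff.mp hu
  exact ⟨v, hv, hxv, hfu.mono hvu⟩

/-- Leibniz's rule combined with the Faà di Bruno estimate. What matters is that the bound is linear
in S with a factor independent of g. Smoothness at a point gives C^n only on some neighbourhood, so
the estimates are made within an open set s. -/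
theorem norm_iteratedFDeriv_mul_comp_le {κ : E → ℂ} {θ : E → F} {g : F → ℂ} {y : E}
    (hκ : ContDiffAt ℝ ∞ κ y) (hθ : ContDiffAt ℝ ∞ θ y) (hg : ContDiffAt ℝ ∞ g (θ y))
    (n : ℕ) {A D S : ℝ} (hD1 : 1 ≤ D)
    (hA : ∀ i ≤ n, ‖iteratedFDeriv ℝ i κ y‖ ≤ A)
    (hD : ∀ i ≤ n, ‖iteratedFDeriv ℝ i θ y‖ ≤ D)
    (hS : ∀ i ≤ n, ‖iteratedFDeriv ℝ i g (θ y)‖ ≤ S) :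
    ‖iteratedFDeriv ℝ n (fun z => κ z * g (θ z)) y‖ ≤
      (∑ i ∈ Finset.range (n + 1), (n.choose i : ℝ) * A * ((n - i).factorial * D ^ (n - i))) * S := by
  obtain ⟨u₁, hu₁, hy₁, hκu⟩ := exists_isOpen_contDiffOn hκ n
  obtain ⟨u₂, hu₂, hy₂, hθu⟩ := exists_isOpen_contDiffOn hθ n
  obtain ⟨t, ht, hyt, hgt⟩ := exists_isOpen_contDiffOn hg n
  have hs : IsOpen (u₁ ∩ (u₂ ∩ θ ⁻¹' t)) :=
    hu₁.inter (hθu.continuousOn.isOpen_inter_preimage hu₂ ht)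
  set s := u₁ ∩ (u₂ ∩ θ ⁻¹' t)
  have hys : y ∈ s := ⟨hy₁, hy₂, hyt⟩
  have hmap : MapsTo θ s t := fun z hz => hz.2.2
  have hκs : ContDiffOn ℝ n κ s := hκu.mono inter_subset_left
  have hθs : ContDiffOn ℝ n θ s := hθu.mono fun z hz => hz.2.1
  have hA0 : 0 ≤ A := (norm_nonneg _).trans (hA 0 (Nat.zero_le _))
  have hcomp : ∀ j ≤ n, ‖iteratedFDerivWithin ℝ j (g ∘ θ) s y‖ ≤ j.factorial * S * D ^ j := by
    intro j hj
    refine norm_iteratedFDerivWithin_comp_le (N := n) hgt hθs (by exact_mod_cast hj)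
      ht.uniqueDiffOn hs.uniqueDiffOn hmap hys (fun i hi => ?_) (fun i hi hij => ?_)
    · rw [iteratedFDerivWithin_of_isOpen i ht hyt]
      exact hS i (hi.trans hj)
    · rw [iteratedFDerivWithin_of_isOpen i hs hys]
      -- The composition estimate asks for a bound D^i on the i-th derivative; D ≤ D^i since D ≥ 1
      -- and i ≥ 1.
      exact (hD i (hij.trans hj)).trans (le_self_pow₀ hD1 (by omega))
  rw [← iteratedFDerivWithin_of_isOpen n hs hys]
  refine (norm_iteratedFDerivWithin_mul_le (N := n) hκs (hgt.comp hθs hmap) hs.uniqueDiffOn hys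
    le_rfl).trans ?_
  rw [Finset.sum_mul]
  refine Finset.sum_le_sum fun i hi => ?_
  have hin : i ≤ n := Nat.lt_succ_iff.mp (Finset.mem_range.mp hi)
  have h1 : ‖iteratedFDerivWithin ℝ i κ s y‖ ≤ A := by
    rw [iteratedFDerivWithin_of_isOpen i hs hys]
    exact hA i hin
  calc (n.choose i : ℝ) * ‖iteratedFDerivWithin ℝ i κ s y‖
        * ‖iteratedFDerivWithin ℝ (n - i) (g ∘ θ) s y‖
      ≤ (n.choose i : ℝ) * A * ((n - i).factorial * S * D ^ (n - i)) := by
        gcongr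
        exact hcomp _ (Nat.sub_le _ _)
    _ = _ := by ring

theorem eventually_norm_iteratedFDeriv_le {G : Type*} [NormedAddCommGroup G] [NormedSpace ℝ G]
    {f : E → G} {x : E} (hf : ContDiffAt ℝ ∞ f x) (n : ℕ) :
    ∃ A : ℝ, 1 ≤ A ∧ ∀ᶠ y in 𝓝 x, ∀ i ≤ n, ‖iteratedFDeriv ℝ i f y‖ ≤ A := by
  have h : ∀ i : ℕ, ContinuousAt (fun y => ‖iteratedFDeriv ℝ i f y‖) x := fun i =>
    (hf.iteratedFDeriv_right (m := 0) (i := i) (by simp; exact_mod_cast le_top)).continuousAt.norm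
  -- The added 1 leaves room for the norms to vary near x and also ensures A ≥ 1.
  refine ⟨∑ i ∈ Finset.range (n + 1), (‖iteratedFDeriv ℝ i f x‖ + 1), ?_, ?_⟩
  · calc (1 : ℝ) ≤ ‖iteratedFDeriv ℝ 0 f x‖ + 1 := by linarith [norm_nonneg (iteratedFDeriv ℝ 0 f x)]
      _ ≤ _ := Finset.single_le_sum (f := fun i => ‖iteratedFDeriv ℝ i f x‖ + 1)
        (fun i _ => by positivity) (by simp)
  · have h' : ∀ᶠ y in 𝓝 x, ∀ i ∈ Finset.range (n + 1),
        ‖iteratedFDeriv ℝ i f y‖ < ‖iteratedFDeriv ℝ i f x‖ + 1 :=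
      (Finset.eventually_all _).mpr fun i _ => (h i).eventually_lt_const (by linarith)
    filter_upwards [h'] with y hy i hi
    have him : i ∈ Finset.range (n + 1) := Finset.mem_range.mpr (Nat.lt_succ_of_le hi)
    exact (hy i him).le.trans (Finset.single_le_sum (f := fun i => ‖iteratedFDeriv ℝ i f x‖ + 1)
      (fun i _ => by positivity) him)

/-- The constant is chosen before both the nearby point y and the function g; this uniformity yields
continuity of g ↦ κ · (g ∘ θ). -/
theorem exists_local_bound_mul_comp {κ : E → ℂ} {θ : E → F} {x : E}
    (hκ : ContDiffAt ℝ ∞ κ x) (hθ : ContDiffAt ℝ ∞ θ x) (n : ℕ) :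
    ∃ C : ℝ, 0 ≤ C ∧ ∀ᶠ y in 𝓝 x, ContDiffAt ℝ ∞ κ y → ContDiffAt ℝ ∞ θ y →
      ∀ (g : F → ℂ) (S : ℝ), ContDiffAt ℝ ∞ g (θ y) →
      (∀ i ≤ n, ‖iteratedFDeriv ℝ i g (θ y)‖ ≤ S) →
      ‖iteratedFDeriv ℝ n (fun z => κ z * g (θ z)) y‖ ≤ C * S := by
  obtain ⟨A, hA1, hA⟩ := eventually_norm_iteratedFDeriv_le hκ n
  obtain ⟨D, hD1, hD⟩ := eventually_norm_iteratedFDeriv_le hθ n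
  refine ⟨_, ?_, (hA.and hD).mono fun y hy hκy hθy g S hg hS =>
    norm_iteratedFDeriv_mul_comp_le hκy hθy hg n hD1 hy.1 hy.2 hS⟩
  positivity

end Calculus

/-! ### Extension by zero and the operators f ↦ k · (f ∘ p). -/

section Extension

variable {E : Type*} [NormedAddCommGroup E] [NormedSpace ℝ E]
  {H : Type*} [TopologicalSpace H] {I : ModelWithCorners ℝ E H}
  {M : Type*} [TopologicalSpace M] [ChartedSpace H M]
  {E' : Type*} [NormedAddCommGroup E'] [NormedSpace ℝ E']
  {H' : Type*} [TopologicalSpace H'] {I' : ModelWithCorners ℝ E' H'}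
  {N : Type*} [TopologicalSpace N] [ChartedSpace H' N]

/-- The extension by zero of a function on an open subset. -/
def zeroExtend {U : Opens M} (f : U → ℂ) : M → ℂ := Function.extend Subtype.val f 0

theorem zeroExtend_coe {U : Opens M} (f : U → ℂ) (x : U) : zeroExtend f x = f x :=
  Subtype.val_injective.extend_apply _ _ _

theorem zeroExtend_of_notMem {U : Opens M} (f : U → ℂ) {x : M} (hx : x ∉ U) :
    zeroExtend f x = 0 :=
  Function.extend_apply' _ _ _ (by rintro ⟨y, rfl⟩; exact hx y.2)

theorem contMDiffAt_zeroExtend {U : Opens M} (f : C^∞⟮I, U; 𝓘(ℝ, ℂ), ℂ⟯) {x : M} (hx : x ∈ U) :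
    ContMDiffAt I 𝓘(ℝ, ℂ) ∞ (zeroExtend f) x := by
  refine (contMDiffAt_subtype_iff (x := ⟨x, hx⟩)).mp ?_
  simp only [zeroExtend_coe]
  exact f.contMDiff _

/-- For a smooth map `p : N → M`, an open subset `U` of `M` and a smooth function `k` on `N`
supported in `p ⁻¹' U`, the operator `f ↦ k * (f ∘ p)` from `C^∞(U)` to `C^∞(N)`, where
`k * (f ∘ p)` is understood to vanish outside `p ⁻¹' U`. -/
def mulPullback (U : Opens M) {p : N → M} (hp : ContMDiff I' I ∞ p)
    (k : C^∞⟮I', N; 𝓘(ℝ, ℂ), ℂ⟯) (hk : tsupport k ⊆ p ⁻¹' U) :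
    C^∞⟮I, U; 𝓘(ℝ, ℂ), ℂ⟯ →ₗ[ℂ] C^∞⟮I', N; 𝓘(ℝ, ℂ), ℂ⟯ where
  toFun f := ⟨fun y => k y * zeroExtend f (p y), contMDiff_of_tsupport fun y hy =>
    k.contMDiff.contMDiffAt.mul ((contMDiffAt_zeroExtend f
      (hk (closure_mono (Function.support_mul_subset_left _ _) hy))).comp y hp.contMDiffAt)⟩
  map_add' f g := by
    ext y
    change k y * zeroExtend (f + g) (p y) = k y * zeroExtend f (p y) + k y * zeroExtend g (p y)
    by_cases h : p y ∈ U
    · have e : ∀ f : U → ℂ, zeroExtend f (p y) = f ⟨p y, h⟩ := fun f => zeroExtend_coe f ⟨p y, h⟩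
      rw [e, e, e, ← mul_add]; rfl
    · simp [zeroExtend_of_notMem _ h]
  map_smul' c f := by
    ext y
    change k y * zeroExtend (c • f) (p y) = c * (k y * zeroExtend f (p y))
    by_cases h : p y ∈ U
    · have e : ∀ f : U → ℂ, zeroExtend f (p y) = f ⟨p y, h⟩ := fun f => zeroExtend_coe f ⟨p y, h⟩
      rw [e, e, mul_left_comm]; rfl
    · simp [zeroExtend_of_notMem _ h]

theorem mulPullback_apply (U : Opens M) {p : N → M} (hp : ContMDiff I' I ∞ p)
    (k : C^∞⟮I', N; 𝓘(ℝ, ℂ), ℂ⟯) (hk : tsupport k ⊆ p ⁻¹' U)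
    (f : C^∞⟮I, U; 𝓘(ℝ, ℂ), ℂ⟯) (y : N) :
    mulPullback U hp k hk f y = k y * zeroExtend f (p y) := rfl

/-- The source of C^∞(M)-linearity in both applications: p = id for the maps to C^∞(M), p =
`Prod.fst` for the map to C^∞(M × U). -/
theorem mulPullback_smul_apply (U : Opens M) {p : N → M} (hp : ContMDiff I' I ∞ p)
    (k : C^∞⟮I', N; 𝓘(ℝ, ℂ), ℂ⟯) (hk : tsupport k ⊆ p ⁻¹' U)
    (g : C^∞⟮I, M; 𝓘(ℝ, ℂ), ℂ⟯) (f : C^∞⟮I, U; 𝓘(ℝ, ℂ), ℂ⟯) (y : N) :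
    mulPullback U hp k hk (g • f) y = g (p y) * mulPullback U hp k hk f y := by
  simp only [mulPullback_apply]
  by_cases h : p y ∈ U
  · have e : ∀ f : U → ℂ, zeroExtend f (p y) = f ⟨p y, h⟩ := fun f => zeroExtend_coe f ⟨p y, h⟩
    rw [e, e, mul_left_comm]; rfl
  · simp [zeroExtend_of_notMem _ h]

end Extension

/-! ### Reading functions in extended charts. -/

section Charts

variable {E : Type*} [NormedAddCommGroup E] [NormedSpace ℝ E]
  {H : Type*} [TopologicalSpace H] {I : ModelWithCorners ℝ E H}
  {M : Type*} [TopologicalSpace M]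

theorem tendsto_extend_symm {e : OpenPartialHomeomorph M H} {x : M} (hx : x ∈ e.source) :
    Tendsto (e.extend I).symm (𝓝 (e.extend I x)) (𝓝 x) := by
  have := e.continuousAt_extend_symm (I := I) hx
  rwa [ContinuousAt, e.extend_left_inv hx] at this

theorem extend_target_mem_nhds [I.Boundaryless] {e : OpenPartialHomeomorph M H} {x : M}
    (hx : x ∈ e.source) : (e.extend I).target ∈ 𝓝 (e.extend I x) :=
  e.isOpen_extend_target.mem_nhds ((e.extend I).map_source (by rwa [e.extend_source]))

theorem iteratedFDeriv_extend_eq_zero {e : OpenPartialHomeomorph M H} {f : M → ℂ} {x : M}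
    (hx : x ∈ e.source) (hf : ∀ᶠ y in 𝓝 x, f y = 0) (n : ℕ) :
    iteratedFDeriv ℝ n (f ∘ (e.extend I).symm) (e.extend I x) = 0 := by
  have h : f ∘ (e.extend I).symm =ᶠ[𝓝 (e.extend I x)] fun _ => 0 :=
    (tendsto_extend_symm hx).eventually hf
  rw [(h.iteratedFDeriv ℝ n).eq_of_nhds]
  simp

end Charts

/-! ### Continuity of f ↦ k · (f ∘ p) for the chart seminorms. -/

section Seminorms

variable {E : Type*} [NormedAddCommGroup E] [NormedSpace ℝ E]
  {H : Type*} [TopologicalSpace H] {I : ModelWithCorners ℝ E H} [I.Boundaryless]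
  {M : Type*} [TopologicalSpace M] [ChartedSpace H M]
  {E' : Type*} [NormedAddCommGroup E'] [NormedSpace ℝ E']
  {H' : Type*} [TopologicalSpace H'] {I' : ModelWithCorners ℝ E' H'} [I'.Boundaryless]
  {N : Type*} [TopologicalSpace N] [ChartedSpace H' N]

instance instIsTopologicalAddGroupSmooth : IsTopologicalAddGroup C^∞⟮I, M; 𝓘(ℝ, ℂ), ℂ⟯ :=
  withSeminorms_chartSeminormFamily.topologicalAddGroup

instance instContinuousSMulSmooth : ContinuousSMul ℂ C^∞⟮I, M; 𝓘(ℝ, ℂ), ℂ⟯ :=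
  withSeminorms_chartSeminormFamily.continuousSMul

theorem norm_iteratedFDeriv_le_chartSeminorm (i : SeminormIndex I M)
    (f : C^∞⟮I, M; 𝓘(ℝ, ℂ), ℂ⟯) {x : M} (hx : x ∈ i.K) :
    ‖iteratedFDeriv ℝ i.n (f ∘ (i.e.extend I).symm) (i.e.extend I x)‖ ≤ chartSeminorm i f :=
  le_ciSup (bddAbove_chart i f) ⟨x, hx⟩

theorem chartSeminorm_le (i : SeminormIndex I M) (f : C^∞⟮I, M; 𝓘(ℝ, ℂ), ℂ⟯) {b : ℝ} (hb : 0 ≤ b)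
    (h : ∀ x ∈ i.K, ‖iteratedFDeriv ℝ i.n (f ∘ (i.e.extend I).symm) (i.e.extend I x)‖ ≤ b) :
    chartSeminorm i f ≤ b :=
  Real.iSup_le (fun x => h x x.2) hb

theorem chartSeminorm_eq_zero (i : SeminormIndex I M) (f : C^∞⟮I, M; 𝓘(ℝ, ℂ), ℂ⟯)
    (hf : ∀ x ∈ i.K, ∀ᶠ y in 𝓝 x, f y = 0) : chartSeminorm i f = 0 := by
  refine le_antisymm (chartSeminorm_le i f le_rfl fun x hx => ?_) (apply_nonneg _ _)
  rw [iteratedFDeriv_extend_eq_zero (i.K_subset hx) (hf x hx), norm_zero]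

/-- Derivatives of the extension by zero in a chart of `M`, at the points of a compact subset
of `U`, are controlled by a seminorm of `C^∞(U)`. -/
theorem exists_seminormIndex_zeroExtend [IsManifold I ∞ M] {U : Opens M} (z : M) {L : Set M}
    (hL : IsCompact L) (hLU : L ⊆ U) (hLc : L ⊆ (chartAt H z).source) (hU : Nonempty U) (n : ℕ) :
    ∃ i : SeminormIndex I U, ∀ f : C^∞⟮I, U; 𝓘(ℝ, ℂ), ℂ⟯, ∀ x ∈ L,
      ‖iteratedFDeriv ℝ n (zeroExtend f ∘ ((chartAt H z).extend I).symm)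
        ((chartAt H z).extend I x)‖ ≤ chartSeminorm i f := by
  set c := chartAt H z
  have hK : IsCompact (Subtype.val ⁻¹' L : Set U) :=
    Topology.IsInducing.subtypeVal.isCompact_preimage' hL (by simpa using hLU)
  let i : SeminormIndex I U := ⟨c.subtypeRestr hU,
    StructureGroupoid.subtypeRestr_mem_maximalAtlas (chart_mem_atlas H z) hU,
    Subtype.val ⁻¹' L, hK, fun x hx => by
      rw [OpenPartialHomeomorph.subtypeRestr_source]; exact hLc hx, n⟩
  refine ⟨i, fun f x hx => ?_⟩
  have h := norm_iteratedFDeriv_le_chartSeminorm i f (x := ⟨x, hLU hx⟩) hx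
  refine le_of_eq_of_le ?_ h
  have hev : zeroExtend f ∘ (c.extend I).symm =ᶠ[𝓝 (c.extend I x)]
      f ∘ ((c.subtypeRestr hU).extend I).symm := by
    have hx' : (⟨x, hLU hx⟩ : U) ∈ (c.subtypeRestr hU).source := by
      rw [OpenPartialHomeomorph.subtypeRestr_source]; exact hLc hx
    have hmem : ((c.subtypeRestr hU).extend I).target ∈ 𝓝 (c.extend I x) :=
      extend_target_mem_nhds hx'
    filter_upwards [hmem] with w hw
    have hw' : I.symm w ∈ (c.subtypeRestr hU).target := by
      rw [OpenPartialHomeomorph.extend_target] at hw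
      exact hw.1
    have := OpenPartialHomeomorph.subtypeRestr_symm_eqOn c hU hw'
    change zeroExtend f (c.symm (I.symm w)) = f ((c.subtypeRestr hU).symm (I.symm w))
    rw [this]
    exact zeroExtend_coe _ _
  rw [(hev.iteratedFDeriv ℝ n).eq_of_nhds]
  rfl

/-- On the support of k, p maps into U, and in the chart e and a chart c at p y the operator has the
form κ · (g ∘ θ), so the calculus estimate applies. Off the support the output vanishes locally. -/
theorem exists_local_seminorm_mulPullback [IsManifold I ∞ M] [IsManifold I' ∞ N]
    [LocallyCompactSpace N] (U : Opens M) {p : N → M} (hp : ContMDiff I' I ∞ p)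
    (k : C^∞⟮I', N; 𝓘(ℝ, ℂ), ℂ⟯) (hk : tsupport k ⊆ p ⁻¹' U)
    {e : OpenPartialHomeomorph N H'} (he : e ∈ IsManifold.maximalAtlas I' ∞ N)
    {y : N} (hy : y ∈ e.source) (n : ℕ) :
    ∃ t ∈ 𝓝 y, ∃ q : Seminorm ℂ C^∞⟮I, U; 𝓘(ℝ, ℂ), ℂ⟯, Continuous q ∧ ∀ f, ∀ x ∈ t,
      ‖iteratedFDeriv ℝ n (mulPullback U hp k hk f ∘ (e.extend I').symm) (e.extend I' x)‖
        ≤ q f := by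
  by_cases hyk : y ∈ tsupport k
  · have hyU : p y ∈ U := hk hyk
    have hU : Nonempty U := ⟨⟨p y, hyU⟩⟩
    set c := chartAt H (p y)
    have hcM : c ∈ IsManifold.maximalAtlas I ∞ M := IsManifold.chart_mem_maximalAtlas (p y)
    set κ : E' → ℂ := k ∘ (e.extend I').symm
    set θ : E' → E := c.extend I ∘ p ∘ (e.extend I').symm
    have hsymm : ∀ x ∈ e.source,
        ContMDiffAt 𝓘(ℝ, E') I' ∞ (e.extend I').symm (e.extend I' x) := fun x hx => by
      have h1 := contMDiffOn_extend_symm (I := I') he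
      rw [← e.extend_target'] at h1
      exact h1.contMDiffAt (extend_target_mem_nhds hx)
    have hκ : ∀ x ∈ e.source, ContDiffAt ℝ ∞ κ (e.extend I' x) := fun x hx =>
      (k.contMDiff.contMDiffAt.comp _ (hsymm x hx)).contDiffAt
    have hce : ∀ z ∈ c.source, ContMDiffAt I 𝓘(ℝ, E) ∞ (c.extend I) z := fun z hz =>
      c.contMDiffAt_extend hcM hz
    have hleft : ∀ x ∈ e.source, (e.extend I').symm (e.extend I' x) = x := fun x hx =>
      e.extend_left_inv hx
    have hθ : ∀ x ∈ e.source, p x ∈ c.source → ContDiffAt ℝ ∞ θ (e.extend I' x) := by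
      intro x hx hpx
      have h1 : ContMDiffAt 𝓘(ℝ, E') I ∞ (p ∘ (e.extend I').symm) (e.extend I' x) :=
        hp.contMDiffAt.comp _ (hsymm x hx)
      refine (ContMDiffAt.comp (g := c.extend I) _ ?_ h1).contDiffAt
      rw [Function.comp_apply, hleft x hx]
      exact hce _ hpx
    have hg : ∀ f : C^∞⟮I, U; 𝓘(ℝ, ℂ), ℂ⟯, ∀ z ∈ c.source, z ∈ U →
        ContDiffAt ℝ ∞ (zeroExtend f ∘ (c.extend I).symm) (c.extend I z) := by
      intro f z hz hzU
      have h1 := contMDiffOn_extend_symm (I := I) hcM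
      rw [← c.extend_target'] at h1
      refine (ContMDiffAt.comp (g := zeroExtend f) _ ?_
        (h1.contMDiffAt (extend_target_mem_nhds hz))).contDiffAt
      rw [c.extend_left_inv hz]
      exact contMDiffAt_zeroExtend f hzU
    obtain ⟨C, hC0, hC⟩ := exists_local_bound_mul_comp (hκ y hy)
      (hθ y hy (mem_chart_source H (p y))) n
    have hW : ∀ᶠ x in 𝓝 y, x ∈ e.source ∧ p x ∈ c.source ∧ p x ∈ U := by
      refine (e.open_source.eventually_mem hy).and (hp.continuous.continuousAt.eventually
        ((c.open_source.eventually_mem (mem_chart_source H (p y))).and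
          (U.isOpen.eventually_mem hyU)))
    -- Compactness of t makes p(t) a compact subset of U inside the chart domain, so suprema over
    -- p(t) are bounded by seminorms of C^∞(U).
    obtain ⟨t, ht, hts, htc⟩ := local_compact_nhds
      (hW.and ((e.continuousAt_extend (I := I') hy).eventually hC))
    choose i hi using fun j => exists_seminormIndex_zeroExtend (I := I) (p y)
      (htc.image hp.continuous) (U := U) (by rintro _ ⟨x, hx, rfl⟩; exact (hts hx).1.2.2)
      (by rintro _ ⟨x, hx, rfl⟩; exact (hts hx).1.2.1) hU j
    set q := (Finset.range (n + 1)).sup fun j => chartSeminorm (i j)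
    have hq : Continuous q := Seminorm.continuous_finsetSup fun j _ =>
      withSeminorms_chartSeminormFamily.continuous_seminorm (i j)
    refine ⟨t, ht, C.toNNReal • q, hq.const_smul _, fun f x hx => ?_⟩
    obtain ⟨⟨hxe, hxc, hxU⟩, hCx⟩ := hts hx
    have hev : mulPullback U hp k hk f ∘ (e.extend I').symm =ᶠ[𝓝 (e.extend I' x)]
        fun z => κ z * (zeroExtend f ∘ (c.extend I).symm) (θ z) := by
      have : ∀ᶠ z in 𝓝 x, p z ∈ c.source :=
        hp.continuous.continuousAt.eventually (c.open_source.mem_nhds hxc)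
      filter_upwards [(tendsto_extend_symm hxe).eventually this] with z hz
      change k _ * zeroExtend f _ = k _ * zeroExtend f ((c.extend I).symm (c.extend I _))
      rw [Function.comp_apply, c.extend_left_inv hz]
    have hθx : θ (e.extend I' x) = c.extend I (p x) := by
      change c.extend I (p _) = _
      rw [hleft x hxe]
    rw [(hev.iteratedFDeriv ℝ n).eq_of_nhds]
    have hg' : ContDiffAt ℝ ∞ (zeroExtend f ∘ (c.extend I).symm) (θ (e.extend I' x)) := by
      rw [hθx]; exact hg f _ hxc hxU
    have hS : ∀ j ≤ n, ‖iteratedFDeriv ℝ j (zeroExtend f ∘ (c.extend I).symm)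
        (θ (e.extend I' x))‖ ≤ q f := by
      intro j hj
      rw [hθx]
      exact (hi j f _ ⟨x, hx, rfl⟩).trans (Seminorm.le_finset_sup_apply
        (p := fun j => chartSeminorm (i j)) (Finset.mem_range.mpr (Nat.lt_succ_of_le hj)))
    have h := hCx (hκ x hxe) (hθ x hxe hxc) _ _ hg' hS
    refine h.trans_eq ?_
    rw [smul_apply, NNReal.smul_def, smul_eq_mul, Real.coe_toNNReal C hC0]
  · refine ⟨e.source ∩ (tsupport k)ᶜ, inter_mem (e.open_source.mem_nhds hy)
      ((isClosed_tsupport k).isOpen_compl.mem_nhds hyk), 0, continuous_const, fun f x hx => ?_⟩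
    rw [iteratedFDeriv_extend_eq_zero hx.1, norm_zero]
    · exact le_rfl
    · filter_upwards [(isClosed_tsupport k).isOpen_compl.mem_nhds hx.2] with z hz
      rw [mulPullback_apply, image_eq_zero_of_notMem_tsupport hz, zero_mul]

/-- The local bounds are patched by compactness of the set defining the target seminorm; on a union
of two sets the seminorms are added. -/
theorem continuous_mulPullback [IsManifold I ∞ M] [IsManifold I' ∞ N]
    [LocallyCompactSpace N] (U : Opens M) {p : N → M} (hp : ContMDiff I' I ∞ p)
    (k : C^∞⟮I', N; 𝓘(ℝ, ℂ), ℂ⟯) (hk : tsupport k ⊆ p ⁻¹' U) :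
    Continuous (mulPullback U hp k hk) := by
  refine WithSeminorms.continuous_of_continuous_comp withSeminorms_chartSeminormFamily _ fun i => ?_
  obtain ⟨q, hq, hqf⟩ : ∃ q : Seminorm ℂ C^∞⟮I, U; 𝓘(ℝ, ℂ), ℂ⟯, Continuous q ∧ ∀ f, ∀ x ∈ i.K,
      ‖iteratedFDeriv ℝ i.n (mulPullback U hp k hk f ∘ (i.e.extend I').symm) (i.e.extend I' x)‖
        ≤ q f := by
    refine i.isCompact_K.induction_on ⟨0, continuous_const, by simp⟩ ?_ ?_ fun y hy => ?_
    · rintro s t hst ⟨q, hq, h⟩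
      exact ⟨q, hq, fun f x hx => h f x (hst hx)⟩
    · rintro s t ⟨q, hq, h⟩ ⟨q', hq', h'⟩
      refine ⟨q + q', hq.add hq', fun f x hx => ?_⟩
      rcases hx with hx | hx
      · exact (h f x hx).trans (le_add_of_nonneg_right (apply_nonneg q' f))
      · exact (h' f x hx).trans (le_add_of_nonneg_left (apply_nonneg q f))
    · obtain ⟨t, ht, q, hq, h⟩ := exists_local_seminorm_mulPullback U hp k hk i.he
        (i.K_subset hy) i.n
      exact ⟨t, mem_nhdsWithin_of_mem_nhds ht, q, hq, h⟩
  exact Seminorm.continuous_of_le hq fun f => chartSeminorm_le i _ (apply_nonneg q f) (hqf f)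

end Seminorms

/-! ### Locally finite families of smooth functions. -/

section LocallyFiniteFamilies

variable {E : Type*} [NormedAddCommGroup E] [NormedSpace ℝ E]
  {H : Type*} [TopologicalSpace H] {I : ModelWithCorners ℝ E H} [I.Boundaryless]
  {M : Type*} [TopologicalSpace M] [ChartedSpace H M] {ι : Type*}

theorem exists_finset_notMem_tsupport {N : Type*} [TopologicalSpace N] {g : ι → N → ℂ}
    (hg : LocallyFinite fun j => Function.support (g j)) {K : Set N} (hK : IsCompact K) :
    ∃ J : Finset ι, ∀ j ∉ J, ∀ x ∈ K, x ∉ tsupport (g j) := by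
  have hfin := hg.closure.finite_nonempty_inter_compact hK
  refine ⟨hfin.toFinset, fun j hj x hx hxj => hj ?_⟩
  rw [Set.Finite.mem_toFinset]
  exact ⟨x, hxj, hx⟩

theorem exists_finset_chartSeminorm_smul_eq_zero {g : ι → C^∞⟮I, M; 𝓘(ℝ, ℂ), ℂ⟯}
    (hg : LocallyFinite fun j => Function.support (g j)) (i : SeminormIndex I M) :
    ∃ J : Finset ι, ∀ j ∉ J, ∀ c : ℂ, chartSeminorm i (c • g j) = 0 := by
  obtain ⟨J, hJ⟩ := exists_finset_notMem_tsupport hg i.isCompact_K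
  refine ⟨J, fun j hj c => chartSeminorm_eq_zero i _ fun x hx => ?_⟩
  filter_upwards [(isClosed_tsupport (g j)).isOpen_compl.mem_nhds (hJ j hj x hx)] with y hy
  rw [complex_smul_apply, image_eq_zero_of_notMem_tsupport hy, mul_zero]

/-- Local finiteness expressed in terms of the topology alone, a form that can be transported along
continuous linear maps. Arbitrary scalars are allowed because the relevant seminorms are exactly
zero, not merely small. -/
theorem exists_finset_smul_mem {g : ι → C^∞⟮I, M; 𝓘(ℝ, ℂ), ℂ⟯}
    (hg : LocallyFinite fun j => Function.support (g j))
    {V : Set C^∞⟮I, M; 𝓘(ℝ, ℂ), ℂ⟯} (hV : V ∈ 𝓝 0) :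
    ∃ J : Finset ι, ∀ j ∉ J, ∀ c : ℂ, c • g j ∈ V := by
  classical
  obtain ⟨s, r, hr, hs⟩ := (withSeminorms_chartSeminormFamily.mem_nhds_iff _ _).mp hV
  choose J hJ using exists_finset_chartSeminorm_smul_eq_zero hg
  refine ⟨s.biUnion J, fun j hj c => hs ?_⟩
  rw [Seminorm.mem_ball_zero]
  refine (Seminorm.finset_sup_apply_le le_rfl fun i hi => ?_).trans_lt hr
  refine (hJ i j (fun h => hj ?_) c).le
  exact Finset.mem_biUnion.mpr ⟨i, hi, h⟩

/-- A partial sum containing every index whose closed support meets K agrees with f on a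
neighbourhood of K, so the seminorm of the error is exactly zero. -/
theorem hasSum_of_locallyFinite {g : ι → C^∞⟮I, M; 𝓘(ℝ, ℂ), ℂ⟯}
    (hg : LocallyFinite fun j => Function.support (g j)) {f : C^∞⟮I, M; 𝓘(ℝ, ℂ), ℂ⟯}
    (hf : ∀ x, ∑ᶠ j, g j x = f x) : HasSum g f := by
  refine (withSeminorms_chartSeminormFamily.tendsto_nhds _ _).mpr fun i ε hε => ?_
  obtain ⟨J, hJ⟩ := exists_finset_notMem_tsupport hg i.isCompact_K
  filter_upwards [eventually_ge_atTop J] with s hs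
  refine lt_of_eq_of_lt (chartSeminorm_eq_zero i _ fun x hx => ?_) hε
  have hlf : LocallyFinite fun j : {j // j ∉ J} => tsupport (g j) :=
    hg.closure.comp_injective Subtype.val_injective
  -- Local finiteness keeps this possibly infinite union closed, so one neighbourhood of x avoids
  -- the supports of all j outside J at once.
  have hO := (hlf.isClosed_iUnion fun j => isClosed_tsupport _).isOpen_compl
  filter_upwards [hO.mem_nhds (by simpa using fun j hj => hJ j hj x hx)] with y hy
  have hsum : (∑ j ∈ s, g j) y = ∑ j ∈ s, g j y := by
    simpa using congrFun (map_sum (ContMDiffMap.coeFnAddMonoidHom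
      (I := I) (N := M) (I' := 𝓘(ℝ, ℂ)) (G := ℂ) (n := ∞)) g s) y
  change (∑ j ∈ s, g j) y - f y = 0
  rw [hsum, ← hf y, sub_eq_zero, finsum_eq_sum_of_support_subset]
  intro j hj
  by_contra hjs
  refine hy (mem_iUnion.mpr ⟨⟨j, fun h => hjs (hs h)⟩, ?_⟩)
  exact subset_tsupport (g j) hj

end LocallyFiniteFamilies

/-! ### Series Σ T_j f • x_j in a locally convex module. -/

section Sums

open scoped ComplexOrder in
theorem locallyConvexSpace_complex (X : Type*) [AddCommGroup X] [Module ℂ X] [TopologicalSpace X]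
    [IsTopologicalAddGroup X] [LocallyConvexSpace ℝ X] : LocallyConvexSpace ℂ X := by
  refine (locallyConvexSpace_iff_exists_convex_subset_zero ℂ X).mpr fun V hV => ?_
  obtain ⟨S, hS, hc, hSV⟩ := (locallyConvexSpace_iff_exists_convex_subset_zero ℝ X).mp ‹_› V hV
  refine ⟨S, hS, convex_of_nonneg_surjective_algebraMap _ (fun z hz => ?_) hc, hSV⟩
  have hz' := Complex.nonneg_iff.mp hz
  exact ⟨z.re, hz'.1, Complex.ext rfl hz'.2⟩

theorem polynormableSpace_complex (X : Type*) [AddCommGroup X] [Module ℂ X] [TopologicalSpace X]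
    [IsTopologicalAddGroup X] [ContinuousSMul ℂ X] [LocallyConvexSpace ℝ X] :
    PolynormableSpace ℂ X := by
  have : ContinuousSMul ℝ X :=
    ⟨(Complex.continuous_ofReal.comp continuous_fst).smul continuous_snd⟩
  have := locallyConvexSpace_complex X
  exact LocallyConvexSpace.toPolynormableSpace

variable {A : Type*} [CommRing A] [Algebra ℂ A] [TopologicalSpace A] [ContinuousSMul ℂ A]
  {X : Type*} [AddCommGroup X] [Module ℂ X] [Module A X] [IsScalarTower ℂ A X]
  {ι : Type*}

/-- Joint continuity gives neighbourhoods O of 0 in A and Q of 0 in X with p(O • Q) < 1. Any a is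
scaled into O by some c ≠ 0, and if ℂ x_j lies in Q the compensating scalar is absorbed there. Hence
p is bounded by 1 on the line ℂ (a • x_j), which forces p(a • x_j) = 0. -/
theorem exists_finset_seminorm_smul_eq_zero [TopologicalSpace X] [ContinuousSMul A X] {x : ι → X}
    (hx : ∀ V ∈ 𝓝 (0 : X), ∃ J : Finset ι, ∀ j ∉ J, ∀ c : ℂ, c • x j ∈ V)
    {p : Seminorm ℂ X} (hp : Continuous p) :
    ∃ J : Finset ι, ∀ j ∉ J, ∀ a : A, p (a • x j) = 0 := by
  have hcont : Continuous fun z : A × X => p (z.1 • z.2) := hp.comp continuous_smul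
  have hnhds : ∀ᶠ z : A × X in 𝓝 0 ×ˢ 𝓝 0, p (z.1 • z.2) < 1 := by
    rw [← nhds_prod_eq]
    exact hcont.continuousAt.eventually_lt_const (by simp)
  obtain ⟨O, hO, Q, hQ, hOQ⟩ := Filter.mem_prod_iff.mp hnhds
  obtain ⟨J, hJ⟩ := hx Q hQ
  refine ⟨J, fun j hj a => ?_⟩
  have hc : ∀ᶠ c : ℂ in 𝓝[≠] 0, c • a ∈ O := by
    have : Continuous fun c : ℂ => c • a := continuous_id.smul continuous_const
    exact (this.tendsto' 0 0 (zero_smul _ _) |>.mono_left nhdsWithin_le_nhds).eventually hO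
  obtain ⟨c, hcO, hc0⟩ := (hc.and self_mem_nhdsWithin).exists
  by_contra hne
  -- The scalar is chosen to cancel c and normalise the value to exactly 1, giving 1 < 1.
  have hlt : p ((c • a) • ((c * p (a • x j) : ℂ)⁻¹ • x j)) < 1 :=
    hOQ (Set.mk_mem_prod hcO (hJ j hj _))
  have hcomm : SMulCommClass ℂ A X := IsScalarTower.to_smulCommClass
  have hpc : (p (a • x j) : ℂ) ≠ 0 := by exact_mod_cast hne
  have hc0' : c ≠ 0 := hc0
  rw [smul_assoc, smul_comm a, smul_smul, mul_inv, mul_inv_cancel_left₀ hc0', map_smul_eq_mul,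
    norm_inv, Complex.norm_real, Real.norm_of_nonneg (apply_nonneg _ _),
    inv_mul_cancel₀ hne] at hlt
  exact lt_irrefl _ hlt

/-- If all but finitely many of the lines `ℂ • x j` lie in any given neighbourhood of zero, then
`f ↦ ∑ j, T j f • x j` is a well-defined continuous morphism, for arbitrary continuous morphisms
`T j` to the algebra. -/
theorem exists_hasSum_smul [UniformSpace X] [IsUniformAddGroup X] [T2Space X] [CompleteSpace X]
    [ContinuousSMul ℂ X] [LocallyConvexSpace ℝ X] [ContinuousSMul A X]
    {P : Type*} [AddCommGroup P] [Module A P] [TopologicalSpace P]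
    (T : ι → P →L[A] A) {x : ι → X}
    (hx : ∀ V ∈ 𝓝 (0 : X), ∃ J : Finset ι, ∀ j ∉ J, ∀ c : ℂ, c • x j ∈ V) :
    ∃ ψ : P →L[A] X, ∀ f, HasSum (fun j => T j f • x j) (ψ f) := by
  classical
  have := polynormableSpace_complex X
  have hX := PolynormableSpace.withSeminorms ℂ X
  have hzero : ∀ (p : Seminorm ℂ X) (J : Finset ι), (∀ j ∉ J, ∀ a : A, p (a • x j) = 0) →
      ∀ (t : Finset ι), Disjoint t J → ∀ f, p (∑ j ∈ t, T j f • x j) = 0 := by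
    intro p J hJ t ht f
    refine le_antisymm ((Finset.le_sum_of_subadditive p (map_zero p).le (map_add_le_add p)
      _ _).trans_eq ?_) (apply_nonneg _ _)
    exact Finset.sum_eq_zero fun j hj => hJ j (Finset.disjoint_left.mp ht hj) _
  -- Cauchy's criterion: finite sums over indices outside J have seminorm zero, and X is complete.
  have hsum : ∀ f, Summable fun j => T j f • x j := by
    intro f
    refine summable_iff_vanishing.mpr fun V hV => ?_
    obtain ⟨s, r, hr, hs⟩ := (hX.mem_nhds_iff _ _).mp hV
    obtain ⟨J, hJ⟩ := exists_finset_seminorm_smul_eq_zero (A := A) hx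
      (Seminorm.continuous_finsetSup (s := s) fun i _ => hX.continuous_seminorm i)
    refine ⟨J, fun t ht => hs ?_⟩
    rw [Seminorm.mem_ball_zero, hzero _ J hJ t ht]
    exact hr
  let ψ : P →ₗ[A] X :=
    { toFun := fun f => ∑' j, T j f • x j
      map_add' := fun f g => by
        simp only [map_add, add_smul]
        exact (hsum f).tsum_add (hsum g)
      map_smul' := fun a f => by
        simp only [map_smul, smul_assoc, RingHom.id_apply]
        exact (hsum f).tsum_const_smul a }
  have hψ : ∀ f, HasSum (fun j => T j f • x j) (ψ f) := fun f => (hsum f).hasSum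
  -- Up to the kernel of p, ψ f is a finite sum whose index set does not depend on f. Applied below
  -- to f - f₀, this reduces continuity of ψ to that of finite sums.
  have heq : ∀ (p : Seminorm ℂ X), Continuous p → ∀ J : Finset ι,
      (∀ j ∉ J, ∀ a : A, p (a • x j) = 0) → ∀ f, p (ψ f) = p (∑ j ∈ J, T j f • x j) := by
    intro p hp J hJ f
    have h1 := (hp.tendsto _).comp (hψ f)
    refine tendsto_nhds_unique h1 (tendsto_const_nhds.congr' ?_)
    filter_upwards [eventually_ge_atTop J] with t ht
    have h2 := hzero p J hJ (t \ J) Finset.sdiff_disjoint f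
    have h3 : ∑ j ∈ t, T j f • x j = ∑ j ∈ t \ J, T j f • x j + ∑ j ∈ J, T j f • x j :=
      (Finset.sum_sdiff ht).symm
    rw [Function.comp_apply, h3]
    refine le_antisymm ?_ ((map_add_le_add p _ _).trans_eq (by rw [h2, zero_add]))
    have h4 := map_sub_le_add p (∑ j ∈ t \ J, T j f • x j + ∑ j ∈ J, T j f • x j)
      (∑ j ∈ t \ J, T j f • x j)
    rwa [add_sub_cancel_left, h2, add_zero] at h4
  refine ⟨⟨ψ, ?_⟩, hψ⟩
  refine continuous_iff_continuousAt.mpr fun f₀ => (hX.tendsto_nhds _ _).mpr fun p ε hε => ?_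
  have hp := hX.continuous_seminorm p
  obtain ⟨J, hJ⟩ := exists_finset_seminorm_smul_eq_zero (A := A) hx hp
  have hcont : Continuous fun f => (p : Seminorm ℂ X)
      (∑ j ∈ J, T j f • x j - ∑ j ∈ J, T j f₀ • x j) :=
    hp.comp ((continuous_finsetSum _ fun j _ =>
      (T j).continuous.smul continuous_const).sub continuous_const)
  filter_upwards [hcont.continuousAt.eventually_lt_const (show _ < ε by simpa using hε)] with f hf
  have h5 := heq p hp J hJ (f - f₀)
  simp only [map_sub, sub_smul, Finset.sum_sub_distrib] at h5
  exact h5.trans_lt hf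

end Sums

/-! ### The dual basis, the lifting and the right inverse of π_U. -/

section Main

variable {E : Type*} [NormedAddCommGroup E] [NormedSpace ℝ E]
  {H : Type*} [TopologicalSpace H] {I : ModelWithCorners ℝ E H}
  {M : Type u} [TopologicalSpace M] [ChartedSpace H M]

/-- The composition of a smooth real function with the inclusion of `ℝ` in `ℂ`. -/
def toComplex (f : C^∞⟮I, M; 𝓘(ℝ), ℝ⟯) : C^∞⟮I, M; 𝓘(ℝ, ℂ), ℂ⟯ :=
  ⟨fun x => (f x : ℂ), Complex.ofRealCLM.contMDiff.comp f.contMDiff⟩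

/-- There are smooth functions `χ j` on `M`, supported in `U`, and a locally finite family of smooth
functions `k j` on `U`, with `∑ j, χ j * k j = 1` on `U`. -/
theorem exists_finsum_mul_eq_one [FiniteDimensional ℝ E] [IsManifold I ∞ M] [T2Space M]
    (U : Opens M) [SigmaCompactSpace U] :
    ∃ (ι : Type u) (χ : ι → C^∞⟮I, M; 𝓘(ℝ, ℂ), ℂ⟯) (k : ι → C^∞⟮I, U; 𝓘(ℝ, ℂ), ℂ⟯),
      (∀ j, tsupport (χ j) ⊆ U) ∧ (LocallyFinite fun j => Function.support (k j)) ∧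
      ∀ x : U, ∑ᶠ j, χ j x * k j x = 1 := by
  obtain ⟨ι, b, -⟩ := SmoothBumpCovering.exists_isSubordinate I (M := U) (s := univ)
    (U := fun _ => univ) isClosed_univ fun _ _ => univ_mem
  have hlf : LocallyFinite fun j => Function.support (b j) := b.locallyFinite
  have hlf2 : LocallyFinite fun j => Function.support fun x => b j x * b j x :=
    hlf.subset fun j => Function.support_mul_subset_left _ _
  have hb : ∀ j, ContMDiff I 𝓘(ℝ) ∞ (b j) := fun j => (b j).contMDiff
  -- Squares supply a bump for each factor: one b_j, compactly supported in U, extends by zero to M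
  -- as χ_j, while b_j / S stays on U as k_j.
  let S : U → ℝ := fun x => ∑ᶠ j, b j x * b j x
  have hS : ContMDiff I 𝓘(ℝ) ∞ S := contMDiff_finsum (fun j => (hb j).mul (hb j)) hlf2
  have hfin : ∀ x, (Function.support fun j => b j x * b j x).Finite := fun x =>
    hlf2.point_finite x
  have hSpos : ∀ x, S x ≠ 0 := by
    intro x
    obtain ⟨j, hj⟩ := b.eventuallyEq_one' x (mem_univ x)
    have hj1 : b j x = 1 := hj.eq_of_nhds
    refine (lt_of_lt_of_le one_pos ?_).ne'
    calc (1 : ℝ) = b j x * b j x := by rw [hj1, one_mul]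
      _ ≤ S x := single_le_finsum j (hfin x) fun i => mul_self_nonneg _
  let χ : ι → C^∞⟮I, M; 𝓘(ℝ, ℂ), ℂ⟯ := fun j =>
    toComplex ⟨_, (hb j).extend_zero (b j).hasCompactSupport⟩
  let k : ι → C^∞⟮I, U; 𝓘(ℝ, ℂ), ℂ⟯ := fun j =>
    toComplex ⟨fun x => b j x * (S x)⁻¹, (hb j).mul (hS.inv₀ hSpos)⟩
  refine ⟨ι, χ, k, fun j => ?_, hlf.subset fun j x hx => ?_, fun x => ?_⟩
  · have h1 : Function.support (χ j) ⊆ Function.support (Function.extend Subtype.val (b j) 0) := by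
      intro x hx h0
      exact hx (congrArg Complex.ofReal h0)
    exact (closure_mono h1).trans
      (((b j).hasCompactSupport.tsupport_extend_zero_subset continuous_subtype_val).trans
        (Subtype.coe_image_subset _ _))
  · have hx' : ((b j x * (S x)⁻¹ : ℝ) : ℂ) ≠ 0 := hx
    exact left_ne_zero_of_mul (Complex.ofReal_ne_zero.mp hx')
  · have h1 : ∀ j, χ j x * k j x = ((b j x * b j x * (S x)⁻¹ : ℝ) : ℂ) := by
      intro j
      change ((Function.extend Subtype.val (b j) 0 (x : M) : ℝ) : ℂ) *
        ((b j x * (S x)⁻¹ : ℝ) : ℂ) = _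
      rw [Subtype.val_injective.extend_apply, ← Complex.ofReal_mul, mul_assoc]
    have h2 : ∑ᶠ j, b j x * b j x * (S x)⁻¹ = 1 := by
      rw [← finsum_mul]
      exact mul_inv_cancel₀ (hSpos x)
    have h3 := Complex.ofRealHom.toAddMonoidHom.map_finsum
      (f := fun j => b j x * b j x * (S x)⁻¹)
      ((hfin x).subset (Function.support_mul_subset_left _ _))
    simp_rw [h1]
    refine h3.symm.trans ?_
    rw [h2]
    exact Complex.ofReal_one

variable [I.Boundaryless] [IsManifold I ∞ M] [LocallyCompactSpace M]

/-- For a smooth function `χ` on `M` supported in `U`, multiplication by `χ` followed by extension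
by zero, as a continuous morphism from `C^∞(U)` to `C^∞(M)`. -/
def mulExtend (U : Opens M) (χ : C^∞⟮I, M; 𝓘(ℝ, ℂ), ℂ⟯) (hχ : tsupport χ ⊆ U) :
    C^∞⟮I, U; 𝓘(ℝ, ℂ), ℂ⟯ →L[C^∞⟮I, M; 𝓘(ℝ, ℂ), ℂ⟯] C^∞⟮I, M; 𝓘(ℝ, ℂ), ℂ⟯ where
  toFun := mulPullback U contMDiff_id χ hχ
  map_add' := map_add _
  map_smul' g f := by
    ext y
    exact mulPullback_smul_apply U contMDiff_id χ hχ g f y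
  cont := continuous_mulPullback U contMDiff_id χ hχ

theorem mulExtend_apply_coe (U : Opens M) (χ : C^∞⟮I, M; 𝓘(ℝ, ℂ), ℂ⟯) (hχ : tsupport χ ⊆ U)
    (f : C^∞⟮I, U; 𝓘(ℝ, ℂ), ℂ⟯) (x : U) : mulExtend U χ hχ f x = χ x * f x :=
  congrArg (χ x * ·) (zeroExtend_coe f x)

theorem isTopologicallyProjective [FiniteDimensional ℝ E] [T2Space M] (U : Opens M)
    [SigmaCompactSpace U] :
    IsTopologicallyProjective.{_, v} C^∞⟮I, M; 𝓘(ℝ, ℂ), ℂ⟯ C^∞⟮I, U; 𝓘(ℝ, ℂ), ℂ⟯ := by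
  intro X Y _ _ _ _ _ _ _ _ _ _ _ _ _ _ _ _ _ _ _ _ _ _ σ τ hτ φ
  obtain ⟨ι, χ, k, hχ, hk, hχk⟩ := exists_finsum_mul_eq_one (I := I) U
  let T := fun j => mulExtend U (χ j) (hχ j)
  -- Complex scalars act as constant functions of C^∞(M), so φ is also ℂ-linear.
  have hφ : ∀ (c : ℂ) (f : C^∞⟮I, U; 𝓘(ℝ, ℂ), ℂ⟯), φ (c • f) = c • φ f := fun c f => by
    rw [← algebraMap_smul C^∞⟮I, M; 𝓘(ℝ, ℂ), ℂ⟯ c (φ f), ← map_smul]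
    rfl
  have hx : ∀ V ∈ 𝓝 (0 : X), ∃ J : Finset ι, ∀ j ∉ J, ∀ c : ℂ, c • τ (φ (k j)) ∈ V := by
    intro V hV
    have hcont : Continuous fun f => τ (φ f) := τ.continuous.comp φ.continuous
    obtain ⟨J, hJ⟩ := exists_finset_smul_mem hk
      ((hcont.tendsto' 0 0 (by simp)).eventually_mem hV)
    refine ⟨J, fun j hj c => ?_⟩
    have h : τ (φ (c • k j)) ∈ V := hJ j hj c
    rwa [hφ, map_smul] at h
  obtain ⟨ψ, hψ⟩ := exists_hasSum_smul T hx
  refine ⟨ψ, fun f => ?_⟩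
  -- Since σ τ = 1, σ(ψ f) and φ f are sums of the same series in the Hausdorff space Y.
  have h1 : HasSum (fun j => φ (T j f • k j)) (σ (ψ f)) := by
    have := (hψ f).map σ σ.continuous
    simpa only [Function.comp_def, map_smul, hτ] using this
  have happ : ∀ j (x : U), (T j f • k j) x = χ j x * k j x * f x := by
    intro j x
    change T j f x * k j x = _
    rw [mulExtend_apply_coe, mul_right_comm]
  have h2 : HasSum (fun j => T j f • k j) f := by
    refine hasSum_of_locallyFinite (hk.subset fun j x hx => ?_) fun x => ?_
    · rw [Function.mem_support, happ] at hx
      exact right_ne_zero_of_mul (left_ne_zero_of_mul hx)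
    · simp_rw [happ]
      rw [← finsum_mul, hχk, one_mul]
  exact h1.unique (h2.map φ φ.continuous)

/-- In M × U the diagonal is closed and disjoint from the closed set of points with first coordinate
outside U, so a smooth cutoff separates them. Vanishing near the latter set, not just on it, puts
the closed support of the cutoff over U. -/
theorem exists_rightInverse_diagRestrict [FiniteDimensional ℝ E] [T2Space M] (U : Opens M)
    [NormalSpace (M × U)] [SigmaCompactSpace (M × U)] :
    ∃ ρ : C^∞⟮I, U; 𝓘(ℝ, ℂ), ℂ⟯ →L[C^∞⟮I, M; 𝓘(ℝ, ℂ), ℂ⟯] C^∞⟮I.prod I, M × U; 𝓘(ℝ, ℂ), ℂ⟯,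
      ∀ f, diagRestrict U (ρ f) = f := by
  have : LocallyCompactSpace U := U.isOpen.locallyCompactSpace
  have hs : IsClosed (Prod.fst ⁻¹' (U : Set M) : Set (M × U))ᶜ :=
    (U.isOpen.preimage continuous_fst).isClosed_compl
  have ht : IsClosed {z : M × U | z.1 = z.2} :=
    isClosed_eq continuous_fst (continuous_subtype_val.comp continuous_snd)
  have hd : Disjoint (Prod.fst ⁻¹' (U : Set M) : Set (M × U))ᶜ {z : M × U | z.1 = z.2} := by
    refine Set.disjoint_left.mpr fun z hz hz' => hz ?_
    change z.1 ∈ U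
    rw [show z.1 = z.2 from hz']
    exact z.2.2
  obtain ⟨k, hk0, hk1, -⟩ := exists_contMDiffMap_zero_one_nhds_of_isClosed (n := ⊤)
    (I.prod I) hs ht hd
  have hk : tsupport (toComplex k) ⊆ Prod.fst ⁻¹' (U : Set M) := by
    intro z hz
    by_contra hzU
    refine (notMem_tsupport_iff_eventuallyEq.mpr ?_) hz
    filter_upwards [(eventually_nhdsSet_iff_forall.mp hk0) z hzU] with w hw
    exact congrArg Complex.ofReal hw
  refine ⟨{ toFun := mulPullback U contMDiff_fst (toComplex k) hk
            map_add' := map_add _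
            map_smul' := fun g f => ?_
            cont := continuous_mulPullback U contMDiff_fst (toComplex k) hk }, fun f => ?_⟩
  · ext z
    exact mulPullback_smul_apply U contMDiff_fst (toComplex k) hk g f z
  · ext x
    change ((k (x, x) : ℝ) : ℂ) * zeroExtend f x = f x
    rw [zeroExtend_coe, hk1.self_of_nhdsSet ((x : M), x) rfl, Complex.ofReal_one, one_mul]

end Main

end SmoothModules

end

theorem theorem2 (m : ℕ) (M : Type u) [TopologicalSpace M] [T2Space M]
    [SecondCountableTopology M] [ChartedSpace (EuclideanSpace ℝ (Fin m)) M]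
    [IsManifold (𝓡 m) ∞ M]
    (U : TopologicalSpace.Opens M)
    (hU : ∃ e ∈ IsManifold.maximalAtlas (𝓡 m) ∞ M, (U : Set M) ⊆ e.source) :
    SmoothModules.IsTopologicallyProjective.{u, v, u}
        C^∞⟮𝓡 m, M; 𝓘(ℝ, ℂ), ℂ⟯ C^∞⟮𝓡 m, U; 𝓘(ℝ, ℂ), ℂ⟯ ∧
      ∃ ρ : C^∞⟮𝓡 m, U; 𝓘(ℝ, ℂ), ℂ⟯ →L[C^∞⟮𝓡 m, M; 𝓘(ℝ, ℂ), ℂ⟯]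
          C^∞⟮(𝓡 m).prod (𝓡 m), M × U; 𝓘(ℝ, ℂ), ℂ⟯,
        ∀ f, SmoothModules.diagRestrict U (ρ f) = f := by
  have : LocallyCompactSpace M := ChartedSpace.locallyCompactSpace (EuclideanSpace ℝ (Fin m)) M
  have : LocallyCompactSpace U := U.isOpen.locallyCompactSpace
  exact ⟨SmoothModules.isTopologicallyProjective U,
    SmoothModules.exists_rightInverse_diagRestrict U⟩
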